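/- Let $\bar{\mathbb Q}\subset\mathbb C$ be the field of algebraic numbers. Let $X$ be a complex affine algebraic variety given by a set of polynomial equations with coefficients in $\bar{\mathbb Q}$. Let $G$ be a connected complex algebraic group defined over $\bar{\mathbb Q}$ (that is, the variety $G$ and its group operations are defined over $\bar{\mathbb Q}$), and let $G$ act on $X$ by a morphism $G\times X\to X$ which is also defined over $\bar{\mathbb Q}$. Assume that $G(\mathbb C)$ has finitely many orbits in $X(\mathbb C)$. Then every $G(\mathbb C)$-orbit in $X(\mathbb C)$ contains an algebraic point, i.e. a point of $X(\bar{\mathbb Q})$ (a point whose coordinates all lie in $\bar{\mathbb Q}$). -/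

import Mathlib

open CategoryTheory AlgebraicGeometry MonoidalCategory CartesianMonoidalCategory
open scoped MonObj

noncomputable section

/-- The field of algebraic numbers: the algebraic closure of `ℚ` inside `ℂ`. -/
abbrev QBar : Type := algebraicClosure ℚ ℂ

/-- The category of schemes over `QBar` (objects and morphisms defined over `QBar`), with its
cartesian monoidal structure, in which `⊗` is the fibre product over `QBar`. -/
abbrev SchQBar : Type 1 := Over (Spec (CommRingCat.of QBar))

/-- The morphism `Spec ℂ ⟶ Spec QBar` given by the inclusion of fields. -/
abbrev specInclusion : Spec (CommRingCat.of ℂ) ⟶ Spec (CommRingCat.of QBar) :=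
  Spec.map (CommRingCat.ofHom (algebraMap QBar ℂ))

/-- `Spec ℂ` as a scheme over `QBar`. -/
abbrev specC : SchQBar := Over.mk specInclusion

/-- `Spec QBar` as a scheme over `QBar`. -/
abbrev specQBar : SchQBar := Over.mk (𝟙 (Spec (CommRingCat.of QBar)))

/-- The complex points `Y(ℂ)` of a scheme `Y` over `QBar`. If `Y` is the closed subscheme of affine
space given by some polynomials over `QBar`, this is the set of their complex solutions.
For a group scheme `G` over `QBar` this is a group, with `g * h = lift g h ≫ μ`; if `G` acts on `X`
by a morphism `γ : G ⊗ X ⟶ X` over `QBar`, then the group `G(ℂ)` acts on the set `X(ℂ)` by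
`g • x = lift g x ≫ γ`. -/
abbrev ComplexPoints (Y : SchQBar) : Type := specC ⟶ Y

/-- The points of `Y` with values in `QBar`. -/
abbrev AlgebraicPoints (Y : SchQBar) : Type := specQBar ⟶ Y

/-- The inclusion `Y(QBar) → Y(ℂ)`. -/
def AlgebraicPoints.toComplex {Y : SchQBar} (p : AlgebraicPoints Y) : ComplexPoints Y :=
  (Over.homMk specInclusion : specC ⟶ specQBar) ≫ p

/-- The complexification of `Y`, its base change to `Spec ℂ`. -/
abbrev complexification (Y : SchQBar) : Scheme :=
  Limits.pullback Y.hom specInclusion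

end

/-!
Fix an algebraic point `p` of `X`. Its orbit map `g ↦ g • p` is a morphism `G ⟶ X` of schemes of
finite type over `QBar`, so by Chevalley's theorem its image is a constructible subset of `X`. A
complex point of `X` lies in the `G(ℂ)`-orbit of `p` if and only if its underlying point lies in
that image: given the latter, the fibre of the orbit map over the complex point is a nonempty scheme
locally of finite type over `ℂ`, which has a complex point by the Nullstellensatz
(`AlgebraicGeometry.exists_lift_of_mem_range`).

Choose one algebraic point in each of the finitely many orbits that have any. The union of the
images of their orbit maps is then constructible. It contains every closed point of `X`, because a
closed point underlies an algebraic point, which lies in one of the chosen orbits. Since `X` is a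
Jacobson space, a constructible set that contains all the closed points is everything
(`Topology.IsConstructible.eq_univ_of_closedPoints_subset`). Hence every complex point lies in one of
the chosen orbits.
-/

theorem Topology.IsConstructible.eq_univ_of_closedPoints_subset {T : Type*} [TopologicalSpace T]
    [JacobsonSpace T] {s : Set T} (hs : IsConstructible s) (h : closedPoints T ⊆ s) :
    s = Set.univ := by
  -- A constructible set and its complement are unions of locally closed sets. Treating both at once
  -- makes the statement stable under complements and unions.
  have key : ∀ x, ∃ Z, IsLocallyClosed Z ∧ x ∈ Z ∧ (Z ⊆ s ∨ Z ⊆ sᶜ) := by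
    clear h
    intro x
    induction hs using IsConstructible.empty_union_induction with
    | open_retrocompact U hU _ =>
      by_cases hx : x ∈ U
      · exact ⟨U, hU.isLocallyClosed, hx, .inl subset_rfl⟩
      · exact ⟨Uᶜ, hU.isClosed_compl.isLocallyClosed, hx, .inr subset_rfl⟩
    | union s _ t _ hs ht =>
      obtain ⟨Z, hZ, hxZ, hZs⟩ := hs
      obtain ⟨W, hW, hxW, hWt⟩ := ht
      exact ⟨Z ∩ W, hZ.inter hW, ⟨hxZ, hxW⟩, by grind⟩
    | compl s _ hs => simpa [or_comm] using hs
  refine Set.eq_univ_of_forall fun x ↦ ?_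
  obtain ⟨Z, hZ, hxZ, hZs | hZs⟩ := key x
  · exact hZs hxZ
  · obtain ⟨y, hy, hy'⟩ := nonempty_inter_closedPoints ⟨x, hxZ⟩ hZ
    exact absurd (h hy') (hZs hy)

namespace AlgebraicGeometry

/-- Over an algebraically closed field `K`, a `K`-valued point of `X` whose underlying point is in
the image of a morphism `f : Y ⟶ X` locally of finite type lifts along `f`. -/
theorem exists_lift_of_mem_range.{u} {K : Type u} [Field K] [IsAlgClosed K] {X Y : Scheme.{u}}
    (f : Y ⟶ X) [LocallyOfFiniteType f] (x : Spec (.of K) ⟶ X)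
    (hx : x (IsLocalRing.closedPoint K) ∈ Set.range f) : ∃ y : Spec (.of K) ⟶ Y, y ≫ f = x := by
  obtain ⟨y, hy⟩ := hx
  obtain ⟨z, -, -⟩ := Scheme.Pullback.exists_preimage_pullback y _ hy
  have : JacobsonSpace ↥(Limits.pullback f x) :=
    LocallyOfFiniteType.jacobsonSpace (Limits.pullback.snd f x)
  -- A closed point of the fibre product is a `K`-point of the fibre of `f` over `x`.
  obtain ⟨w, -, hw : IsClosed {w}⟩ :=
    nonempty_inter_closedPoints ⟨z, Set.mem_univ z⟩ isClosed_univ.isLocallyClosed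
  refine ⟨pointOfClosedPoint (Limits.pullback.snd f x) w hw ≫ Limits.pullback.fst f x, ?_⟩
  rw [Category.assoc, Limits.pullback.condition, pointOfClosedPoint_comp_assoc]

end AlgebraicGeometry

/-- The orbit map `g ↦ g • p` of an algebraic point `p`, as a morphism over `QBar`. -/
noncomputable def orbitMap {X : SchQBar} (G : SchQBar) [GrpObj G] [ModObj G X]
    (p : AlgebraicPoints X) : G ⟶ X :=
  𝟙 G • ((Over.homMk G.hom : G ⟶ specQBar) ≫ p)

theorem comp_orbitMap {X G : SchQBar} [GrpObj G] [ModObj G X] (p : AlgebraicPoints X)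
    (g : ComplexPoints G) : g ≫ orbitMap G p = g • p.toComplex := by
  have h : g ≫ (Over.homMk G.hom : G ⟶ specQBar) = Over.homMk specInclusion := by
    ext1
    exact Over.w g
  rw [orbitMap, ModObj.comp_smul, Category.comp_id, reassoc_of% h, AlgebraicPoints.toComplex]

instance locallyOfFiniteType_orbitMap {X G : SchQBar} [GrpObj G] [LocallyOfFiniteType G.hom]
    [ModObj G X] (p : AlgebraicPoints X) : LocallyOfFiniteType (orbitMap G p).left :=
  have : LocallyOfFiniteType ((orbitMap G p).left ≫ X.hom) := by rwa [Over.w]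
  locallyOfFiniteType_of_comp _ X.hom

theorem mem_orbit_iff_mem_range_orbitMap {X G : SchQBar} [GrpObj G] [LocallyOfFiniteType G.hom]
    [ModObj G X] (p : AlgebraicPoints X) (x : ComplexPoints X) :
    x ∈ MulAction.orbit (ComplexPoints G) p.toComplex ↔
      x.left (IsLocalRing.closedPoint ℂ) ∈ Set.range (orbitMap G p).left := by
  constructor
  · rintro ⟨g, rfl⟩
    refine ⟨g.left (IsLocalRing.closedPoint ℂ), ?_⟩
    change _ = (g • p.toComplex).left _
    rw [← comp_orbitMap, Over.comp_left]
    exact (Scheme.Hom.comp_apply _ _ _).symm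
  · intro h
    obtain ⟨y, hy⟩ := exists_lift_of_mem_range (orbitMap G p).left x.left h
    refine ⟨Over.homMk y ?_, ?_⟩
    · rw [← Over.w (orbitMap G p), reassoc_of% hy]
      exact Over.w x
    · change _ • _ = _
      rw [← comp_orbitMap]
      ext1
      simpa using hy

theorem isConstructible_range_orbitMap {X G : SchQBar} [IsAffine X.left]
    [LocallyOfFiniteType X.hom] [GrpObj G] [LocallyOfFiniteType G.hom] [QuasiCompact G.hom]
    [ModObj G X] (p : AlgebraicPoints X) :
    Topology.IsConstructible (Set.range (orbitMap G p).left) := by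
  have : IsLocallyNoetherian X.left := LocallyOfFiniteType.isLocallyNoetherian X.hom
  have : QuasiCompact ((orbitMap G p).left ≫ X.hom) := by rwa [Over.w]
  have : QuasiCompact (orbitMap G p).left := .of_comp _ X.hom
  rw [← Set.image_univ]
  exact Scheme.Hom.isConstructible_image _ .univ

/-- The residue field of a closed point of `X` is finite over the algebraically closed field `QBar`,
hence equal to it. -/
theorem exists_algebraicPoint_of_isClosed {X : SchQBar} [LocallyOfFiniteType X.hom] {z : X.left}
    (hz : IsClosed {z}) :
    ∃ q : AlgebraicPoints X, q.toComplex.left (IsLocalRing.closedPoint ℂ) = z := by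
  have : IsAlgClosed QBar := (algebraicClosure.isAlgClosure ℚ ℂ).isAlgClosed
  refine ⟨Over.homMk (pointOfClosedPoint X.hom z hz) (pointOfClosedPoint_comp X.hom z hz), ?_⟩
  rw [AlgebraicPoints.toComplex, Over.comp_left]
  exact (Scheme.Hom.comp_apply _ _ _).trans (pointOfClosedPoint_apply _ _ _ _)

theorem lemma4
    -- `X` is an affine scheme of finite type over the field of algebraic numbers
    (X : SchQBar) [IsAffine X.left] [LocallyOfFiniteType X.hom]
    -- `G` is an algebraic group over that field, whose complexification is connected
    (G : SchQBar) [GrpObj G] [LocallyOfFiniteType G.hom] [QuasiCompact G.hom]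
    [ConnectedSpace (complexification G)]
    -- `G` acts on `X` by a morphism over that field, with finitely many complex orbits
    [ModObj G X]
    [Finite (MulAction.orbitRel.Quotient (ComplexPoints G) (ComplexPoints X))]
    -- an arbitrary orbit
    (O : MulAction.orbitRel.Quotient (ComplexPoints G) (ComplexPoints X)) :
    ∃ p : AlgebraicPoints X, p.toComplex ∈ O.orbit := by
  obtain ⟨x, rfl⟩ := Quotient.exists_rep O
  have : JacobsonSpace X.left := LocallyOfFiniteType.jacobsonSpace X.hom
  -- The orbits that contain an algebraic point, with one such point in each of them.
  let S : Set (MulAction.orbitRel.Quotient (ComplexPoints G) (ComplexPoints X)) :=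
    {o | ∃ p : AlgebraicPoints X, p.toComplex ∈ o.orbit}
  choose p hp using fun o : S ↦ o.2
  have hcov : ⋃ o : S, Set.range (orbitMap G (p o)).left = Set.univ := by
    refine (Topology.IsConstructible.iUnion fun o ↦
      isConstructible_range_orbitMap (p o)).eq_univ_of_closedPoints_subset fun z hz ↦ ?_
    obtain ⟨q, rfl⟩ := exists_algebraicPoint_of_isClosed hz
    let o : S := ⟨Quotient.mk _ q.toComplex, q, MulAction.mem_orbit_self _⟩
    exact Set.mem_iUnion.2 ⟨o, (mem_orbit_iff_mem_range_orbitMap _ _).1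
      (MulAction.mem_orbit_symm.1 (hp o))⟩
  obtain ⟨o, ho⟩ := Set.mem_iUnion.1
    (hcov.symm ▸ Set.mem_univ (x.left (IsLocalRing.closedPoint ℂ)))
  exact ⟨p o, MulAction.mem_orbit_symm.1 ((mem_orbit_iff_mem_range_orbitMap _ _).2 ho)⟩
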